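/- For complex $a, q$ write $(a;q)_n = \prod_{k=0}^{n-1}(1-aq^k)$ for integers $n \ge 0$ (so $(a;q)_0=1$) and, when $|q|<1$, $(a;q)_\infty = \prod_{k=0}^{\infty}(1-aq^k)$. Then for every $q \in \mathbb{C}$ with $|q|<1$, $$\sum_{n=0}^{\infty}\frac{q^{2n^2}\,(q;q^2)_n}{(-q;q^2)_n\,(q^4;q^4)_n} = \frac{(q^3;q^6)_\infty^2\,(q^6;q^6)_\infty}{(q^2;q^2)_\infty},$$ where the series on the left converges absolutely. -/

import Mathlib

/-- The finite `q`-shifted factorial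
`(a; q)_n = (1 - a) (1 - a q) ⋯ (1 - a q ^ (n - 1))`, with `(a; q)_0 = 1`. -/
def qPoch (a q : ℂ) (n : ℕ) : ℂ :=
  ∏ k ∈ Finset.range n, (1 - a * q ^ k)

/-- The infinite `q`-shifted factorial `(a; q)_∞ = ∏_{k ≥ 0} (1 - a q ^ k)`, used for `|q| < 1`,
where the product converges (see `qPoch_multipliable`). -/
noncomputable def qPochInf (a q : ℂ) : ℂ :=
  ∏' k : ℕ, (1 - a * q ^ k)

/-- For `|q| < 1` the product that defines `(a; q)_∞` converges unconditionally, so that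
`qPochInf a q` is its value and not a default value. -/
theorem qPoch_multipliable (a q : ℂ) (hq : ‖q‖ < 1) :
    Multipliable fun k : ℕ => 1 - a * q ^ k := by
  have h : Summable fun k : ℕ => ‖-(a * q ^ k)‖ := by
    simp only [norm_neg, norm_mul, norm_pow]
    exact (summable_geometric_of_lt_one (norm_nonneg q) hq).mul_left ‖a‖
  simpa only [sub_eq_add_neg] using multipliable_one_add_of_summable h

/-- For `|q| < 1`, `(a; q)_∞` is the limit of `(a; q)_n` as `n → ∞`. -/
theorem qPoch_tendsto (a q : ℂ) (hq : ‖q‖ < 1) :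
    Filter.Tendsto (qPoch a q) Filter.atTop (nhds (qPochInf a q)) :=
  (qPoch_multipliable a q hq).hasProd.tendsto_prod_nat

open Filter Topology

/-! ### Finite and infinite q-shifted factorials -/

section qPochhammer

/-! This is a Bailey pair argument. A finite Jacobi triple product (`finiteTheta_mul_qPoch`), with
`qPoch_sq_two_mul`, turns the `n`-th summand into `q^(2n²)` times a sum over `r` of `(-1)^r q^(r²) /
((q²; q²)_{n-r} (q²; q²)_{n+r})`. Absolute convergence lets the sums be exchanged; Cauchy's identity
(`cauchySum_eq`) evaluates the sum over `n` as `q^(2r²) / (q²; q²)_∞`. What remains is the theta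
series in `q³`, a product by `tsum_thetaTerm`. -/

theorem qPoch_succ (a q : ℂ) (n : ℕ) : qPoch a q (n + 1) = qPoch a q n * (1 - a * q ^ n) :=
  Finset.prod_range_succ _ _

theorem one_sub_mul_pow_ne_zero {a q : ℂ} (ha : ‖a‖ < 1) (hq : ‖q‖ < 1) (k : ℕ) :
    1 - a * q ^ k ≠ 0 := by
  intro h
  have h1 : ‖a * q ^ k‖ < 1 := by
    rw [norm_mul, norm_pow]
    calc ‖a‖ * ‖q‖ ^ k ≤ ‖a‖ * 1 :=
          mul_le_mul_of_nonneg_left (pow_le_one₀ (norm_nonneg _) hq.le) (norm_nonneg _)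
      _ < 1 := by simpa using ha
  rw [← sub_eq_zero.mp h] at h1
  simp at h1

theorem qPoch_ne_zero {a q : ℂ} (ha : ‖a‖ < 1) (hq : ‖q‖ < 1) (n : ℕ) : qPoch a q n ≠ 0 :=
  Finset.prod_ne_zero_iff.mpr fun k _ => one_sub_mul_pow_ne_zero ha hq k

theorem qPochInf_ne_zero {a q : ℂ} (ha : ‖a‖ < 1) (hq : ‖q‖ < 1) : qPochInf a q ≠ 0 := by
  have h := tprod_one_add_ne_zero_of_summable (R := ℂ) (f := fun k : ℕ => -(a * q ^ k))
    (fun k => by simpa [sub_eq_add_neg] using one_sub_mul_pow_ne_zero ha hq k)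
    (by
      simp only [norm_neg, norm_mul, norm_pow]
      exact (summable_geometric_of_lt_one (norm_nonneg q) hq).mul_left ‖a‖)
  simpa [qPochInf, sub_eq_add_neg] using h

/-- `(q²; q²)_{2n} = (q; q²)_n (-q; q²)_n (q⁴; q⁴)_n`. -/
theorem qPoch_sq_two_mul (q : ℂ) (n : ℕ) :
    qPoch (q ^ 2) (q ^ 2) (n + n) =
      qPoch q (q ^ 2) n * (qPoch (-q) (q ^ 2) n * qPoch (q ^ 4) (q ^ 4) n) := by
  induction n with
  | zero => simp [qPoch]
  | succ n ih =>
    rw [show n + 1 + (n + 1) = n + n + 1 + 1 by ring]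
    simp only [qPoch_succ, ih]
    ring

end qPochhammer

/-! ### Reciprocal factorials on the integers -/

section reciprocal

/-- The reciprocal `1 / (q; q)_k`, extended by zero to negative integers `k`. -/
noncomputable def qRecip (q : ℂ) (k : ℤ) : ℂ :=
  if k < 0 then 0 else (qPoch q q k.toNat)⁻¹

theorem qRecip_of_neg {q : ℂ} {k : ℤ} (hk : k < 0) : qRecip q k = 0 := if_pos hk

theorem qRecip_natCast (q : ℂ) (k : ℕ) : qRecip q k = (qPoch q q k)⁻¹ := by
  simp [qRecip]

theorem qRecip_mul {q : ℂ} (hq : ‖q‖ < 1) (k : ℤ) :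
    qRecip q k * (1 - q ^ k.toNat) = qRecip q (k - 1) := by
  rcases lt_trichotomy k 0 with hk | rfl | hk
  · rw [qRecip_of_neg hk, qRecip_of_neg (by lia), zero_mul]
  -- The factor `1 - q^0 = 0` matches the extension by zero.
  · rw [qRecip_of_neg (k := 0 - 1) (by lia)]
    simp
  · obtain ⟨n, rfl⟩ : ∃ n : ℕ, k = ((n + 1 : ℕ) : ℤ) := ⟨(k - 1).toNat, by lia⟩
    rw [show (((n + 1 : ℕ) : ℤ) - 1) = (n : ℤ) by push_cast; ring, qRecip_natCast,
      qRecip_natCast, qPoch_succ, Int.toNat_natCast]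
    have h1 := qPoch_ne_zero hq hq n
    have h2 := one_sub_mul_pow_ne_zero hq hq n
    rw [pow_succ', mul_inv, mul_assoc, inv_mul_cancel₀ h2, mul_one]

theorem qRecip_tendsto {q : ℂ} (hq : ‖q‖ < 1) :
    Tendsto (qRecip q) atTop (𝓝 (qPochInf q q)⁻¹) := by
  have h1 : Tendsto (fun k : ℤ => (qPoch q q k.toNat)⁻¹) atTop (𝓝 (qPochInf q q)⁻¹) := by
    refine ((qPoch_tendsto q q hq).inv₀ (qPochInf_ne_zero hq hq)).comp ?_
    exact tendsto_atTop.mpr fun b => (eventually_ge_atTop (b : ℤ)).mono fun k hk => by lia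
  refine h1.congr' ?_
  filter_upwards [eventually_ge_atTop (0 : ℤ)] with k hk
  rw [qRecip, if_neg (by lia)]

theorem exists_norm_qRecip_le {q : ℂ} (hq : ‖q‖ < 1) :
    ∃ C : ℝ, 0 ≤ C ∧ ∀ k, ‖qRecip q k‖ ≤ C := by
  obtain ⟨C, hC⟩ := (((qRecip_tendsto hq).comp
    tendsto_natCast_atTop_atTop).norm.bddAbove_range)
  refine ⟨C, (norm_nonneg _).trans (hC ⟨0, rfl⟩), fun k => ?_⟩
  rcases lt_or_ge k 0 with hk | hk
  · rw [qRecip_of_neg hk, norm_zero]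
    exact (norm_nonneg _).trans (hC ⟨0, rfl⟩)
  · obtain ⟨n, rfl⟩ := Int.eq_ofNat_of_zero_le hk
    exact hC ⟨n, rfl⟩

end reciprocal

/-! ### Finite and infinite Jacobi triple product -/

section theta

/-- The general term `(-1) ^ r q ^ (r ^ 2)` of the theta series. -/
noncomputable def thetaTerm (q : ℂ) (r : ℤ) : ℂ := (-1) ^ r * q ^ (r.natAbs ^ 2)

theorem norm_thetaTerm (q : ℂ) (r : ℤ) : ‖thetaTerm q r‖ = ‖q‖ ^ (r.natAbs ^ 2) := by
  simp [thetaTerm, norm_zpow]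

theorem summable_pow_sq {x : ℝ} (h0 : 0 ≤ x) (h1 : x < 1) :
    Summable fun n : ℕ => x ^ (n ^ 2) :=
  (summable_geometric_of_lt_one h0 h1).of_nonneg_of_le (fun _ => pow_nonneg h0 _)
    fun n => pow_le_pow_of_le_one h0 h1.le (Nat.le_self_pow two_ne_zero n)

theorem summable_norm_thetaTerm {q : ℂ} (hq : ‖q‖ < 1) : Summable fun r => ‖thetaTerm q r‖ := by
  simp only [norm_thetaTerm]
  apply Summable.of_nat_of_neg <;>
    simpa using summable_pow_sq (norm_nonneg q) hq

theorem thetaTerm_neg (q : ℂ) (r : ℤ) : thetaTerm q (-r) = thetaTerm q r := by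
  simp [thetaTerm, zpow_neg, ← inv_zpow]

theorem thetaTerm_add_one (q : ℂ) (m : ℕ) {r : ℤ} (hr : r ≤ m) :
    thetaTerm q (r + 1) * (q ^ 2) ^ (m - r : ℤ).toNat = -q ^ (2 * m + 1) * thetaTerm q r := by
  have h : (r + 1).natAbs ^ 2 + 2 * (m - r : ℤ).toNat = 2 * m + 1 + r.natAbs ^ 2 := by
    zify
    rw [Int.toNat_of_nonneg (by lia), sq_abs, sq_abs]
    ring
  rw [thetaTerm, thetaTerm, zpow_add_one₀ (by norm_num), mul_assoc, ← pow_mul, ← pow_add, h,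
    pow_add]
  ring

theorem norm_mul_qRecip_le {q : ℂ} {C : ℝ} (hC0 : 0 ≤ C) (hC : ∀ k, ‖qRecip q k‖ ≤ C)
    (x : ℂ) (i j : ℤ) : ‖x * (qRecip q i * qRecip q j)‖ ≤ ‖x‖ * (C * C) := by
  rw [norm_mul, norm_mul]
  gcongr
  exacts [hC i, hC j]

theorem norm_sq_lt_one {q : ℂ} (hq : ‖q‖ < 1) : ‖q ^ 2‖ < 1 := by
  rw [norm_pow]
  exact pow_lt_one₀ (norm_nonneg _) hq two_ne_zero

theorem summable_thetaTerm_mul {q : ℂ} (hq : ‖q‖ < 1) (f g : ℤ → ℤ) :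
    Summable fun r => thetaTerm q r * (qRecip (q ^ 2) (f r) * qRecip (q ^ 2) (g r)) := by
  obtain ⟨C, hC0, hC⟩ := exists_norm_qRecip_le (norm_sq_lt_one hq)
  exact .of_norm_bounded ((summable_norm_thetaTerm hq).mul_right (C * C))
    fun r => norm_mul_qRecip_le hC0 hC _ _ _

/-- The truncated theta series
`∑_{r = -n}^{m} (-1) ^ r q ^ (r ^ 2) / ((q²; q²)_{m - r} (q²; q²)_{n + r})`. -/
noncomputable def finiteTheta (q : ℂ) (m n : ℕ) : ℂ :=
  ∑' r : ℤ, thetaTerm q r * (qRecip (q ^ 2) (m - r) * qRecip (q ^ 2) (n + r))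

theorem finiteTheta_comm (q : ℂ) (m n : ℕ) : finiteTheta q m n = finiteTheta q n m := by
  rw [finiteTheta, ← (Equiv.neg ℤ).tsum_eq]
  refine tsum_congr fun r => ?_
  simp only [Equiv.neg_apply, thetaTerm_neg, sub_neg_eq_add, ← sub_eq_add_neg]
  ring

/-- With `i = m + 1 - r` and `j = n + r`, this is `1 - q^(i+j) = (1 - q^i) + q^i (1 - q^j)`. -/
theorem qRecip_mul_split {q : ℂ} (hq : ‖q‖ < 1) (m n : ℕ) (r : ℤ) :
    (1 - q ^ (m + 1 + n)) * (qRecip q (m + 1 - r) * qRecip q (n + r)) =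
      qRecip q (m - r) * qRecip q (n + r) +
        q ^ (m + 1 - r).toNat * (qRecip q (m + 1 - r) * qRecip q (n + r - 1)) := by
  rw [← qRecip_mul hq (n + r), show (m - r : ℤ) = m + 1 - r - 1 by ring,
    ← qRecip_mul hq (m + 1 - r)]
  by_cases h1 : (m + 1 - r : ℤ) < 0
  · simp [qRecip_of_neg h1]
  by_cases h2 : (n + r : ℤ) < 0
  · simp [qRecip_of_neg h2]
  rw [show m + 1 + n = (m + 1 - r : ℤ).toNat + (n + r : ℤ).toNat by lia, pow_add]
  ring

/-- Of the two sums produced by `qRecip_mul_split`, the second becomes a multiple of the first under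
`r ↦ r + 1`, since `(r+1)² + 2(m-r) = r² + 2m + 1`. -/
theorem finiteTheta_succ {q : ℂ} (hq : ‖q‖ < 1) (m n : ℕ) :
    (1 - (q ^ 2) ^ (m + 1 + n)) * finiteTheta q (m + 1) n =
      (1 - q ^ (2 * m + 1)) * finiteTheta q m n := by
  set b : ℤ → ℂ := fun r => thetaTerm q r *
    ((q ^ 2) ^ (m + 1 - r : ℤ).toNat *
      (qRecip (q ^ 2) (m + 1 - r) * qRecip (q ^ 2) (n + r - 1))) with hb
  have hshift : ∀ r, b (r + 1) = -q ^ (2 * m + 1) *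
      (thetaTerm q r * (qRecip (q ^ 2) (m - r) * qRecip (q ^ 2) (n + r))) := by
    intro r
    simp only [hb]
    rw [show (m + 1 - (r + 1) : ℤ) = m - r by ring, show (n + (r + 1) - 1 : ℤ) = n + r by ring]
    by_cases hr : r ≤ m
    · linear_combination (qRecip (q ^ 2) (m - r) * qRecip (q ^ 2) (n + r)) *
        thetaTerm_add_one q m hr
    · simp [qRecip_of_neg (q := q ^ 2) (show (m - r : ℤ) < 0 by lia)]
  have hsum := summable_thetaTerm_mul hq (fun r => m - r) (fun r => n + r)
  have hbs : Summable b := by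
    rw [← (Equiv.addRight (1 : ℤ)).summable_iff]
    exact (hsum.mul_left (-q ^ (2 * m + 1))).congr fun r => (hshift r).symm
  have hbt : ∑' r, b r = -q ^ (2 * m + 1) * finiteTheta q m n := by
    rw [← (Equiv.addRight (1 : ℤ)).tsum_eq, finiteTheta, ← tsum_mul_left]
    exact tsum_congr hshift
  calc (1 - (q ^ 2) ^ (m + 1 + n)) * finiteTheta q (m + 1) n
      = ∑' r, (thetaTerm q r * (qRecip (q ^ 2) (m - r) * qRecip (q ^ 2) (n + r)) + b r) := by
        rw [finiteTheta, ← tsum_mul_left]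
        refine tsum_congr fun r => ?_
        have := qRecip_mul_split (norm_sq_lt_one hq) m n r
        push_cast
        linear_combination thetaTerm q r * this
    _ = (1 - q ^ (2 * m + 1)) * finiteTheta q m n := by
        rw [hsum.tsum_add hbs, hbt, ← finiteTheta]
        ring

theorem finiteTheta_zero_zero (q : ℂ) : finiteTheta q 0 0 = 1 := by
  rw [finiteTheta, tsum_eq_single 0]
  · simp [thetaTerm, qRecip, qPoch]
  · intro r hr
    rcases lt_or_gt_of_ne hr with h | h
    · simp [qRecip_of_neg h]
    · simp [qRecip_of_neg (q := q ^ 2) (show -r < 0 by lia)]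

theorem finiteTheta_mul_qPoch_aux {q : ℂ} (hq : ‖q‖ < 1) (m n : ℕ) :
    finiteTheta q m n * qPoch (q ^ 2) (q ^ 2) (m + n) =
      qPoch q (q ^ 2) m * (finiteTheta q 0 n * qPoch (q ^ 2) (q ^ 2) n) := by
  induction m with
  | zero => simp [qPoch]
  | succ m ih =>
    rw [show m + 1 + n = m + n + 1 by ring, qPoch_succ, qPoch_succ]
    have h := finiteTheta_succ hq m n
    linear_combination (1 - q * (q ^ 2) ^ m) * ih + qPoch (q ^ 2) (q ^ 2) (m + n) * h

/-- A finite form of the Jacobi triple product at `z = 1`. -/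
theorem finiteTheta_mul_qPoch {q : ℂ} (hq : ‖q‖ < 1) (m n : ℕ) :
    finiteTheta q m n * qPoch (q ^ 2) (q ^ 2) (m + n) = qPoch q (q ^ 2) m * qPoch q (q ^ 2) n := by
  -- The recurrence only raises the first index; symmetry reduces the remaining case `(0, n)` to
  -- `(n, 0)`.
  have h := finiteTheta_mul_qPoch_aux hq n 0
  rw [finiteTheta_mul_qPoch_aux hq m n, finiteTheta_comm q 0 n]
  rw [finiteTheta_zero_zero, add_zero] at h
  rw [h]
  simp [qPoch]

/-- The Jacobi triple product at `z = 1`: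
`∑_{r ∈ ℤ} (-1) ^ r q ^ (r ^ 2) = (q; q²)_∞² (q²; q²)_∞`. -/
theorem tsum_thetaTerm {q : ℂ} (hq : ‖q‖ < 1) :
    ∑' r, thetaTerm q r = qPochInf q (q ^ 2) ^ 2 * qPochInf (q ^ 2) (q ^ 2) := by
  have hQ := norm_sq_lt_one hq
  have hne := qPochInf_ne_zero hQ hQ
  set L := qPochInf (q ^ 2) (q ^ 2) with hL
  obtain ⟨C, hC0, hC⟩ := exists_norm_qRecip_le hQ
  have hlim : Tendsto (fun n : ℕ => finiteTheta q n n) atTop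
      (𝓝 (∑' r, thetaTerm q r * (L⁻¹ * L⁻¹))) := by
    refine tendsto_tsum_of_dominated_convergence
      ((summable_norm_thetaTerm hq).mul_right (C * C)) (fun r => ?_)
      (.of_forall fun n r => norm_mul_qRecip_le hC0 hC _ _ _)
    refine tendsto_const_nhds.mul (.mul ?_ ?_)
    · exact (qRecip_tendsto hQ).comp
        (tendsto_atTop_add_const_right _ (-r) tendsto_natCast_atTop_atTop)
    · exact (qRecip_tendsto hQ).comp
        (tendsto_atTop_add_const_right _ r tendsto_natCast_atTop_atTop)
  have hdouble : Tendsto (fun n : ℕ => n + n) atTop atTop :=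
    tendsto_atTop_mono (fun n => Nat.le_add_right n n) tendsto_id
  have h1 := hlim.mul ((qPoch_tendsto (q ^ 2) (q ^ 2) hQ).comp hdouble)
  have h2 := (qPoch_tendsto q (q ^ 2) hQ).mul (qPoch_tendsto q (q ^ 2) hQ)
  have h3 := tendsto_nhds_unique (h1.congr fun n => finiteTheta_mul_qPoch hq n n) h2
  rw [tsum_mul_right, ← hL] at h3
  field_simp at h3
  rw [h3, mul_comm]

end theta

/-! ### Cauchy's identity -/

section Cauchy

theorem summable_cauchyTerm {q : ℂ} (hq : ‖q‖ < 1) (a : ℕ) (f g : ℕ → ℤ) :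
    Summable fun m : ℕ => q ^ (m ^ 2 + m * a) * (qRecip q (f m) * qRecip q (g m)) := by
  obtain ⟨C, hC0, hC⟩ := exists_norm_qRecip_le hq
  refine .of_norm_bounded ((summable_pow_sq (norm_nonneg q) hq).mul_right (C * C)) fun m => ?_
  refine (norm_mul_qRecip_le hC0 hC _ _ _).trans ?_
  rw [norm_pow]
  gcongr ?_ * _
  exact pow_le_pow_of_le_one (norm_nonneg _) hq.le (Nat.le_add_right _ _)

/-- The series `∑_m q ^ (m ^ 2 + m a) / ((q; q)_m (q; q)_{m + a})`. -/
noncomputable def cauchySum (q : ℂ) (a : ℕ) : ℂ :=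
  ∑' m : ℕ, q ^ (m ^ 2 + m * a) * (qRecip q m * qRecip q (m + a))

theorem cauchySum_tendsto {q : ℂ} (hq : ‖q‖ < 1) :
    Tendsto (cauchySum q) atTop (𝓝 (qPochInf q q)⁻¹) := by
  obtain ⟨C, hC0, hC⟩ := exists_norm_qRecip_le hq
  have h : Tendsto (cauchySum q) atTop
      (𝓝 (∑' m : ℕ, if m = 0 then (qPochInf q q)⁻¹ else 0)) := by
    refine tendsto_tsum_of_dominated_convergence
      ((summable_pow_sq (norm_nonneg q) hq).mul_right (C * C)) (fun m => ?_)
      (.of_forall fun a m => ?_)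
    · have hR : Tendsto (fun a : ℕ => qRecip q (m + a)) atTop (𝓝 (qPochInf q q)⁻¹) :=
        (qRecip_tendsto hq).comp
          (tendsto_atTop_add_const_left _ (m : ℤ) tendsto_natCast_atTop_atTop)
      rcases eq_or_ne m 0 with rfl | hm
      · simpa [qRecip, qPoch] using hR
      · rw [if_neg hm]
        have hp : Tendsto (fun a : ℕ => q ^ (m ^ 2 + m * a)) atTop (𝓝 0) :=
          (tendsto_pow_atTop_nhds_zero_of_norm_lt_one hq).comp
            (tendsto_atTop_mono (fun a => (Nat.le_mul_of_pos_left a (Nat.pos_of_ne_zero hm)).trans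
              (Nat.le_add_left _ _)) tendsto_id)
        simpa using hp.mul (tendsto_const_nhds.mul hR)
    · refine (norm_mul_qRecip_le hC0 hC _ _ _).trans ?_
      rw [norm_pow]
      gcongr ?_ * _
      exact pow_le_pow_of_le_one (norm_nonneg _) hq.le (Nat.le_add_right _ _)
  simpa using h

theorem qRecip_natCast_succ_mul {q : ℂ} (hq : ‖q‖ < 1) (k : ℕ) :
    qRecip q (k + 1) * (1 - q ^ (k + 1)) = qRecip q k := by
  have h := qRecip_mul hq ((k + 1 : ℕ) : ℤ)
  simpa using h

/-- Over the common factor `1 / ((q; q)_m (q; q)_{m+a+1})` the difference of terms has numerator `(1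
- q^m) - q^(m+a+1)`; the first part is reindexed by `m ↦ m + 1`. -/
theorem cauchySum_sub_eq {q : ℂ} (hq : ‖q‖ < 1) (a : ℕ) :
    cauchySum q a - cauchySum q (a + 1) =
      -q ^ (a + 1) * (cauchySum q (a + 1) - cauchySum q (a + 2)) := by
  set u : ℕ → ℂ := fun m => q ^ (m ^ 2 + m * a) * (qRecip q (m - 1) * qRecip q (m + a + 1))
    with hu
  have hus : Summable u := summable_cauchyTerm hq a (fun m => m - 1) (fun m => m + a + 1)
  have hs1 := summable_cauchyTerm hq (a + 1) (fun m => m) (fun m => m + (a + 1 : ℕ))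
  have hs0 := summable_cauchyTerm hq a (fun m => m) (fun m => m + a)
  have hu0 : u 0 = 0 := by simp [hu, qRecip_of_neg]
  have hut : ∑' m, u m = q ^ (a + 1) * cauchySum q (a + 2) := by
    rw [hus.tsum_eq_zero_add, hu0, zero_add, cauchySum, ← tsum_mul_left]
    refine tsum_congr fun m => ?_
    simp only [hu]
    push_cast
    rw [add_sub_cancel_right, show (m + 1 + a + 1 : ℤ) = m + (a + 2) by ring]
    ring
  have h1 : cauchySum q a - cauchySum q (a + 1) =
      ∑' m, u m - q ^ (a + 1) * cauchySum q (a + 1) := by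
    rw [cauchySum, cauchySum, ← tsum_mul_left, ← hs0.tsum_sub hs1,
      ← hus.tsum_sub (hs1.mul_left _)]
    refine tsum_congr fun m => ?_
    have e1 := qRecip_natCast_succ_mul hq (m + a)
    have e2 := qRecip_mul hq (m : ℤ)
    simp only [hu]
    rw [← e2, Int.toNat_natCast]
    push_cast at e1 ⊢
    rw [← e1, show (m + (a + 1) : ℤ) = m + a + 1 by ring]
    ring
  rw [h1, hut]
  ring

/-- Cauchy's identity `∑_m q ^ (m ^ 2 + m a) / ((q; q)_m (q; q)_{m + a}) = 1 / (q; q)_∞`. -/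
theorem cauchySum_eq {q : ℂ} (hq : ‖q‖ < 1) (a : ℕ) : cauchySum q a = (qPochInf q q)⁻¹ := by
  have hle : ∀ a, ‖cauchySum q a - cauchySum q (a + 1)‖ ≤
      ‖cauchySum q (a + 1) - cauchySum q (a + 2)‖ := by
    intro a
    rw [cauchySum_sub_eq hq, norm_mul, norm_neg, norm_pow]
    exact mul_le_of_le_one_left (norm_nonneg _) (pow_le_one₀ (norm_nonneg _) hq.le)
  -- Nonnegative, nondecreasing and tending to `0`, these differences all vanish, so the sum equals
  -- its limit in `a`.
  have hmono : Monotone fun a => ‖cauchySum q a - cauchySum q (a + 1)‖ := monotone_nat_of_le_succ hle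
  have hlim := cauchySum_tendsto hq
  have h0 : Tendsto (fun a => ‖cauchySum q a - cauchySum q (a + 1)‖) atTop (𝓝 0) := by
    simpa using (hlim.sub (hlim.comp (tendsto_add_atTop_nat 1))).norm
  have hstep : ∀ a, cauchySum q (a + 1) = cauchySum q a := fun a =>
    (sub_eq_zero.mp (norm_le_zero_iff.mp (hmono.ge_of_tendsto h0 a))).symm
  have hconst : ∀ k, cauchySum q (k + a) = cauchySum q a := by
    intro k
    induction k with
    | zero => simp
    | succ k ih => rw [← ih, ← hstep (k + a)]; congr 1; ring
  exact tendsto_nhds_unique (tendsto_const_nhds.congr fun k => (hconst k).symm)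
    (hlim.comp (tendsto_add_atTop_nat a))

/-- Terms with `n < |r|` vanish; `n = m + |r|` gives `n² = m² + 2m|r| + r²`, Cauchy's sum at `a =
2|r|`. -/
theorem tsum_pow_sq_mul_qRecip {q : ℂ} (hq : ‖q‖ < 1) (r : ℤ) :
    ∑' n : ℕ, q ^ (n ^ 2) * (qRecip q (n - r) * qRecip q (n + r)) =
      q ^ (r.natAbs ^ 2) * (qPochInf q q)⁻¹ := by
  set k := r.natAbs with hk
  have hsymm : ∀ n : ℕ, qRecip q (n - r) * qRecip q (n + r) =
      qRecip q (n - k) * qRecip q (n + k) := by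
    intro n
    rcases Int.natAbs_eq r with h | h <;> rw [h]
    rw [← hk, sub_neg_eq_add, ← sub_eq_add_neg, mul_comm]
  simp only [hsymm]
  have hs : Summable fun n : ℕ => q ^ (n ^ 2) * (qRecip q (n - k) * qRecip q (n + k)) := by
    simpa using summable_cauchyTerm hq 0 (fun n => n - k) (fun n => n + k)
  rw [← hs.sum_add_tsum_nat_add k, Finset.sum_eq_zero, zero_add, ← cauchySum_eq hq (2 * k),
    cauchySum, ← tsum_mul_left]
  · refine tsum_congr fun m => ?_
    push_cast
    rw [add_sub_cancel_right, show (m + k + k : ℤ) = m + 2 * k by ring]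
    ring
  · intro n hn
    rw [qRecip_of_neg (q := q) (show (n - k : ℤ) < 0 by have := Finset.mem_range.mp hn; lia)]
    simp

end Cauchy

/-! ### Exchange of summations and conclusion -/

theorem pow_natAbs_mul_thetaTerm (q : ℂ) (r : ℤ) :
    thetaTerm q r * (q ^ 2) ^ (r.natAbs ^ 2) = thetaTerm (q ^ 3) r := by
  simp only [thetaTerm]
  ring

/-- The limiting Bailey lemma, applied to the pair given by `finiteTheta`. -/
theorem hasSum_pow_mul_finiteTheta {q : ℂ} (hq : ‖q‖ < 1) :
    HasSum (fun n : ℕ => (q ^ 2) ^ (n ^ 2) * finiteTheta q n n)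
      ((∑' r, thetaTerm (q ^ 3) r) * (qPochInf (q ^ 2) (q ^ 2))⁻¹) := by
  have hQ := norm_sq_lt_one hq
  obtain ⟨C, hC0, hC⟩ := exists_norm_qRecip_le hQ
  set f : ℕ × ℤ → ℂ := fun p => ((q ^ 2) ^ (p.1 ^ 2) * thetaTerm q p.2) *
    (qRecip (q ^ 2) (p.1 - p.2) * qRecip (q ^ 2) (p.1 + p.2)) with hf
  have hfs : Summable f := by
    have h := ((summable_pow_sq (norm_nonneg _) hQ).mul_of_nonneg (summable_norm_thetaTerm hq)
      (fun _ => by positivity) (fun r => norm_nonneg _)).mul_right (C * C)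
    refine .of_norm_bounded h fun p => (norm_mul_qRecip_le hC0 hC _ _ _).trans ?_
    rw [norm_mul, norm_pow (q ^ 2)]
  have hinner : ∀ n : ℕ, (q ^ 2) ^ (n ^ 2) * finiteTheta q n n = ∑' r, f (n, r) := by
    intro n
    rw [finiteTheta, ← tsum_mul_left]
    exact tsum_congr fun r => by simp only [hf]; ring
  have htot : ∑' p, f p = (∑' r, thetaTerm (q ^ 3) r) * (qPochInf (q ^ 2) (q ^ 2))⁻¹ := by
    have hcomm : ∑' n, ∑' r, f (n, r) = ∑' r, ∑' n, f (n, r) :=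
      Summable.tsum_comm (f := fun r n => f (n, r)) hfs.prod_symm
    rw [hfs.tsum_prod, hcomm, ← tsum_mul_right]
    refine tsum_congr fun r => ?_
    rw [← pow_natAbs_mul_thetaTerm, mul_assoc, ← tsum_pow_sq_mul_qRecip hQ, ← tsum_mul_left]
    exact tsum_congr fun n => by simp only [hf]; ring
  simp only [hinner, ← htot]
  exact hfs.hasSum.prod_fiberwise fun n => (hfs.prod_factor n).hasSum

theorem corollary3p5 (q : ℂ) (hq : ‖q‖ < 1) :
    HasSum
      (fun n : ℕ =>
        q ^ (2 * n ^ 2) * qPoch q (q ^ 2) n /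
          (qPoch (-q) (q ^ 2) n * qPoch (q ^ 4) (q ^ 4) n))
      (qPochInf (q ^ 3) (q ^ 6) ^ 2 * qPochInf (q ^ 6) (q ^ 6) / qPochInf (q ^ 2) (q ^ 2)) := by
  have hQ := norm_sq_lt_one hq
  have hq3 : ‖q ^ 3‖ < 1 := by
    rw [norm_pow]
    exact pow_lt_one₀ (norm_nonneg _) hq three_ne_zero
  have hq6 : (q ^ 3) ^ 2 = q ^ 6 := by ring
  have hmain := hasSum_pow_mul_finiteTheta hq
  rw [tsum_thetaTerm hq3, hq6, ← div_eq_mul_inv] at hmain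
  refine hmain.congr_fun fun n => ?_
  have h1 := qPoch_ne_zero hq hQ n
  have h2 := qPoch_ne_zero hQ hQ (n + n)
  have h := finiteTheta_mul_qPoch hq n n
  rw [qPoch_sq_two_mul] at h h2
  have h3 := right_ne_zero_of_mul h2
  rw [div_eq_iff h3, pow_mul]
  -- One of the two factors `(q; q²)_n` cancels against `(q²; q²)_{2n}`.
  apply mul_left_cancel₀ h1
  linear_combination -(q ^ 2) ^ n ^ 2 * h
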